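/- Let $\mathcal H,\mathcal K$ be complex Hilbert spaces and let $A\in B(\mathcal H)^d$, $B\in B(\mathcal K)^d$ be $d$-tuples of bounded operators. Norms of tuples are maxima over the entries: $\|X-Y\|=\max_i\|X_i-Y_i\|$. For a tuple $A$, let $C^*(A)$ be the unital C*-subalgebra of $B(\mathcal H)$ generated by $A_1,\dots,A_d$, and for $n\ge 1$ let $$\mathcal W_n(A)=\{(\varphi(A_1),\dots,\varphi(A_d)) : \varphi\colon C^*(A)\to M_n(\mathbb C)\ \text{unital completely positive}\}$$ be the $n$-th level of its matrix range. The one-sided matrix range distance and the matrix range distance are $$d_{\mathrm{mr}}(A\to B)=\sup_{n\ge 1}\ \sup_{X\in\mathcal W_n(A)}\ \inf_{Y\in\mathcal W_n(B)}\|X-Y\|,\qquad d_{\mathrm{mr}}(A,B)=\sup_{n\ge 1} d_{\mathrm H}\bigl(\mathcal W_n(A),\mathcal W_n(B)\bigr)=\max\{d_{\mathrm{mr}}(A\to B),d_{\mathrm{mr}}(B\to A)\},$$ where $d_{\mathrm H}$ is the Hausdorff distance. Write $A\sim A'$ if there is a $*$-isomorphism $C^*(A)\to C^*(A')$ mapping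 $A_i$ to $A'_i$ for all $i$. Write $C\prec B$ if there are a Hilbert space $\mathcal L$, a closed subspace $\mathcal M\subseteq\mathcal L$, and tuples $U\in B(\mathcal M)^d$, $V\in B(\mathcal L)^d$ with $C\sim U$, $B\sim V$ and $U_i=P_{\mathcal M}V_i|_{\mathcal M}$ for all $i$. The one-sided relaxed dilation distance and the relaxed dilation distance are $$d_{\mathrm{rD}}(A\to B)=\inf\{\|A'-C\| : A',C\in B(\mathcal L)^d \text{ for some Hilbert space }\mathcal L,\ A'\sim A,\ C\prec B\},\qquad d_{\mathrm{rD}}(A,B)=\max\{d_{\mathrm{rD}}(A\to B),d_{\mathrm{rD}}(B\to A)\}.$$ All these quantities take values in $[0,\infty]$, with $\sup\emptyset=0$ and $\inf\emptyset=\infty$. Then $$d_{\mathrm{mr}}(A\to B)=d_{\mathrm{rD}}(A\to B)\qquad\text{and}\qquad d_{\mathrm{mr}}(A,B)=d_{\mathrm{rD}}(A,B).$$ -/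

import Mathlib

universe u

noncomputable section

namespace OperatorTuple

variable {d : ℕ}
variable {H : Type u} [NormedAddCommGroup H] [InnerProductSpace ℂ H] [CompleteSpace H]
variable {K : Type u} [NormedAddCommGroup K] [InnerProductSpace ℂ K] [CompleteSpace K]

/-- `C*(A)`: the unital C*-subalgebra of `B(H)` generated by the operators `A 0, …, A (d - 1)`. -/
def cstar (A : Fin d → H →L[ℂ] H) : StarSubalgebra ℂ (H →L[ℂ] H) :=
  (StarAlgebra.adjoin ℂ (Set.range A)).topologicalClosure

instance isClosed_cstar (A : Fin d → H →L[ℂ] H) :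
    IsClosed (cstar A : Set (H →L[ℂ] H)) :=
  StarSubalgebra.isClosed_topologicalClosure _

/-- The operator `A i`, viewed as an element of `C*(A)`. -/
def gen (A : Fin d → H →L[ℂ] H) (i : Fin d) : cstar A :=
  ⟨A i, StarSubalgebra.le_topologicalClosure _
    (StarAlgebra.subset_adjoin ℂ _ (Set.mem_range_self i))⟩

/-- The order that `C*(A)` inherits from the order of `B(H)` is its order as a C*-algebra. -/
instance starOrderedRing_cstar (A : Fin d → H →L[ℂ] H) : StarOrderedRing (cstar A) := by
  refine StarOrderedRing.of_nonneg_iff' (fun {x y} hxy z => ?_) (fun x => ⟨fun hx => ?_, ?_⟩)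
  · exact add_le_add_right (α := H →L[ℂ] H) hxy z
  · have hx' : (0 : H →L[ℂ] H) ≤ x := hx
    have h1 : IsSelfAdjoint x := Subtype.ext (IsSelfAdjoint.of_nonneg hx').star_eq
    have h2 : SpectrumRestricts x ContinuousMap.realToNNReal := by
      rw [SpectrumRestricts.nnreal_iff]
      intro r hr
      refine spectrum_nonneg_of_nonneg hx' ?_
      rw [← spectrum.preimage_algebraMap ℂ] at hr ⊢
      rwa [Set.mem_preimage, StarSubalgebra.spectrum_eq] at hr
    obtain ⟨s, hs, -, hsx⟩ := CFC.exists_sqrt_of_isSelfAdjoint_of_quasispectrumRestricts h1 h2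
    exact ⟨s, by rw [hs.star_eq, hsx]⟩
  · rintro ⟨s, rfl⟩
    exact star_mul_self_nonneg (s : H →L[ℂ] H)

/-- `M_n`, realized as the C*-algebra of operators on the Hilbert space `ℂⁿ`. -/
abbrev Mat (n : ℕ) : Type := EuclideanSpace ℂ (Fin n) →L[ℂ] EuclideanSpace ℂ (Fin n)

/-- The `n`-th level `W_n(A) = {φ(A) : φ ∈ UCP(C*(A), M_n)}` of the matrix range of `A`. -/
def matrixRange (n : ℕ) (A : Fin d → H →L[ℂ] H) : Set (Fin d → Mat n) :=
  {X | ∃ φ : CompletelyPositiveMap (cstar A) (Mat n), φ 1 = 1 ∧ ∀ i, φ (gen A i) = X i}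

/-- The one-sided matrix range distance. The norm of a tuple is the largest norm of an entry. -/
def dmrTo (A : Fin d → H →L[ℂ] H) (B : Fin d → K →L[ℂ] K) : ENNReal :=
  ⨆ (n : ℕ) (_ : 1 ≤ n), ⨆ X ∈ matrixRange n A, ⨅ Y ∈ matrixRange n B, ‖X - Y‖ₑ

/-- The matrix range distance: the supremum over all levels of the Hausdorff distance. -/
def dmr (A : Fin d → H →L[ℂ] H) (B : Fin d → K →L[ℂ] K) : ENNReal :=
  ⨆ (n : ℕ) (_ : 1 ≤ n), Metric.hausdorffEDist (matrixRange n A) (matrixRange n B)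

/-- The matrix range distance is the larger one of the two one-sided distances. -/
theorem dmr_eq_max (A : Fin d → H →L[ℂ] H) (B : Fin d → K →L[ℂ] K) :
    dmr A B = max (dmrTo A B) (dmrTo B A) := by
  simp only [dmr, dmrTo, Metric.hausdorffEDist_def, Metric.infEDist, edist_eq_enorm_sub,
    iSup_sup_eq]

/-- `A ∼ B`: some *-isomorphism `C*(A) → C*(B)` maps `A i` to `B i` for all `i`. -/
def Equivalent (A : Fin d → H →L[ℂ] H) (B : Fin d → K →L[ℂ] K) : Prop :=
  ∃ φ : cstar A ≃⋆ₐ[ℂ] cstar B, ∀ i, φ (gen A i) = gen B i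

/-- `A ≺ B`: there are a Hilbert space `L`, a closed subspace `M` of `L`, and tuples `U ∼ A` on `M`
and `V ∼ B` on `L` such that `U` is the compression of `V` to `M`. -/
def DilatesTo (A : Fin d → H →L[ℂ] H) (B : Fin d → K →L[ℂ] K) : Prop :=
  ∃ (L : Type u) (_ : NormedAddCommGroup L) (_ : InnerProductSpace ℂ L) (_ : CompleteSpace L)
    (M : Submodule ℂ L) (_ : CompleteSpace M) (U : Fin d → M →L[ℂ] M) (V : Fin d → L →L[ℂ] L),
    Equivalent A U ∧ Equivalent B V ∧
      ∀ i, U i = M.orthogonalProjectionOnto ∘L V i ∘L M.subtypeL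

/-- The one-sided relaxed dilation distance: the infimum of `‖A' - C‖` over all Hilbert spaces `L`
and all tuples `A' ∼ A` and `C ≺ B` on `L`. -/
def drDTo (A : Fin d → H →L[ℂ] H) (B : Fin d → K →L[ℂ] K) : ENNReal :=
  sInf {r | ∃ (L : Type u) (_ : NormedAddCommGroup L) (_ : InnerProductSpace ℂ L)
    (_ : CompleteSpace L) (A' C : Fin d → L →L[ℂ] L),
    Equivalent A A' ∧ DilatesTo C B ∧ r = ‖A' - C‖ₑ}

/-- The relaxed dilation distance. -/
def drD (A : Fin d → H →L[ℂ] H) (B : Fin d → K →L[ℂ] K) : ENNReal :=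
  max (drDTo A B) (drDTo B A)

end OperatorTuple

end

noncomputable section

namespace OperatorTuple

open scoped InnerProductSpace ComplexOrder ComplexConjugate

/-! ### Positive elements of C*-algebras -/

section Order

variable {S : Type*} [NonUnitalCStarAlgebra S] [PartialOrder S] [StarOrderedRing S]

/-! Only the one-sided identity needs proof; the symmetric one is the maximum of two of them. For mr
≤ rD, let `A' ∼ A` and `C ≺ B` act on `L`. A unital completely positive (UCP) map on C*(A) with
value `X` at `A` extends, by Arveson's theorem (`IsCP.exists_extension`), to a UCP map `Φ` on all of
B(L) with `Φ(A') = X`. Then `Φ(C)` lies in the matrix range of `C`, hence in that of `B`, and UCP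
maps are contractive (`IsCP.norm_le`), so `X` is within `‖A' - C‖` of it. For rD ≤ mr, let `t`
exceed the matrix range distance. Compressing `A` to a finite-dimensional subspace gives a point of
its matrix range, hence a UCP image of `B` within `t`. An ultrafilter limit over finite sets of
vectors produces a UCP map `ψ` from C*(B) to B(H) with `‖A i - ψ (B i)‖ ≤ t`
(`exists_isCP_norm_sub_le`). Stinespring's theorem (`IsCP.exists_dilation`) with a faithful summand
added gives `ψ(B) ≺ B` (`IsCP.dilatesTo`), so `A` and `ψ(B)` are admissible in the infimum. -/

theorem exists_eq_star_mul_self {a : S} (ha : 0 ≤ a) : ∃ r, a = star r * r :=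
  CStarAlgebra.nonneg_iff_eq_star_mul_self.1 ha

theorem star_eq_of_nonneg {a : S} (ha : 0 ≤ a) : star a = a :=
  (IsSelfAdjoint.of_nonneg ha).star_eq

theorem exists_orthogonal_decomposition {a : S} (ha : IsSelfAdjoint a) :
    ∃ p q : S, 0 ≤ p ∧ 0 ≤ q ∧ a = p - q ∧ p * q = 0 :=
  ⟨a⁺, a⁻, CFC.posPart_nonneg a, CFC.negPart_nonneg a, (CFC.posPart_sub_negPart a ha).symm,
    CFC.posPart_mul_negPart a⟩

end Order

/-! ### Complete positivity through quadratic forms, and its agreement with the matricial definition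
-/

section CompletePositivity

variable {S : Type*} [Ring S] [StarRing S] [Algebra ℂ S]
variable {E : Type*} [NormedAddCommGroup E] [InnerProductSpace ℂ E]

/-- Complete positivity of an operator-valued linear map, expressed by its quadratic forms. -/
def IsCP (φ : S →ₗ[ℂ] (E →L[ℂ] E)) : Prop :=
  ∀ (k : ℕ) (a : Fin k → S) (x : Fin k → E),
    0 ≤ ∑ i, ∑ j, ⟪x i, φ (star (a i) * a j) (x j)⟫_ℂ

theorem IsCP.sum_nonneg {φ : S →ₗ[ℂ] (E →L[ℂ] E)} (hφ : IsCP φ) {ι : Type*} [Fintype ι]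
    (a : ι → S) (x : ι → E) : 0 ≤ ∑ i, ∑ j, ⟪x i, φ (star (a i) * a j) (x j)⟫_ℂ := by
  have h := hφ _ (a ∘ (Fintype.equivFin ι).symm) (x ∘ (Fintype.equivFin ι).symm)
  simp only [Function.comp_apply] at h
  rw [(Fintype.equivFin ι).symm.sum_comp
    (fun i => ∑ j, ⟪x i, φ (star (a i) * a ((Fintype.equivFin ι).symm j))
      (x ((Fintype.equivFin ι).symm j))⟫_ℂ)] at h
  convert h using 2 with i
  exact ((Fintype.equivFin ι).symm.sum_comp
    (fun j => ⟪x i, φ (star (a i) * a j) (x j)⟫_ℂ)).symm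

theorem IsCP.inner_nonneg {φ : S →ₗ[ℂ] (E →L[ℂ] E)} (hφ : IsCP φ) (a : S) (x : E) :
    0 ≤ ⟪x, φ (star a * a) x⟫_ℂ := by
  simpa using hφ 1 (fun _ => a) (fun _ => x)

theorem IsCP.pair_nonneg {φ : S →ₗ[ℂ] (E →L[ℂ] E)} (hφ : IsCP φ) (a : S) (x y : E) :
    0 ≤ ⟪x, φ 1 x⟫_ℂ + ⟪x, φ a y⟫_ℂ + (⟪y, φ (star a) x⟫_ℂ + ⟪y, φ (star a * a) y⟫_ℂ) := by
  simpa [Fin.sum_univ_two] using hφ 2 ![1, a] ![x, y]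

/-- The two-vector form is real and so are its diagonal terms, so the imaginary parts of the cross
terms cancel; replacing `x` by `i x` handles the real parts. -/
theorem IsCP.inner_star {φ : S →ₗ[ℂ] (E →L[ℂ] E)} (hφ : IsCP φ) (a : S) (x y : E) :
    ⟪x, φ (star a) y⟫_ℂ = ⟪φ a x, y⟫_ℂ := by
  have key : ∀ x y : E, (⟪x, φ a y⟫_ℂ).im + (⟪y, φ (star a) x⟫_ℂ).im = 0 := fun x y => by
    have h1 := (Complex.nonneg_iff.1 (hφ.pair_nonneg a x y)).2
    have h2 := (Complex.nonneg_iff.1 (hφ.inner_nonneg 1 x)).2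
    have h3 := (Complex.nonneg_iff.1 (hφ.inner_nonneg a y)).2
    simp only [Complex.add_im, star_one, mul_one] at h1 h2
    linarith
  have h1 := key y x
  have h2 := key y (Complex.I • x)
  simp only [map_smul, inner_smul_left, inner_smul_right, Complex.conj_I, Complex.mul_im,
    Complex.I_re, Complex.I_im, Complex.neg_re, Complex.neg_im] at h2
  rw [← inner_conj_symm (φ a x) y]
  apply Complex.ext <;> simp only [Complex.conj_re, Complex.conj_im] <;> linarith

theorem IsCP.map_star [CompleteSpace E] {φ : S →ₗ[ℂ] (E →L[ℂ] E)} (hφ : IsCP φ) (a : S) :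
    φ (star a) = star (φ a) := by
  ext y
  refine ext_inner_left ℂ fun x => ?_
  rw [hφ.inner_star, ContinuousLinearMap.star_eq_adjoint, ContinuousLinearMap.adjoint_inner_right]

end CompletePositivity

section MatrixAction

variable {E : Type*} [NormedAddCommGroup E] [InnerProductSpace ℂ E]
variable {k : ℕ}

/-- The action of an operator matrix on a column of vectors. -/
def act (M : CStarMatrix (Fin k) (Fin k) (E →L[ℂ] E)) (x : Fin k → E) : Fin k → E :=
  fun i => ∑ j, M i j (x j)

/-- The sesquilinear pairing of two columns of vectors. -/
def pairing (x y : Fin k → E) : ℂ := ∑ i, ⟪x i, y i⟫_ℂ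

theorem act_mul (M N : CStarMatrix (Fin k) (Fin k) (E →L[ℂ] E)) (x : Fin k → E) :
    act (M * N) x = act M (act N x) := by
  ext i
  simp only [act, CStarMatrix.mul_apply, map_sum, sum_apply,
    mul_apply_eq_comp]
  exact Finset.sum_comm

theorem pairing_self_nonneg (x : Fin k → E) : 0 ≤ pairing x x :=
  Finset.sum_nonneg fun i _ => by
    rw [inner_self_eq_norm_sq_to_K]
    positivity

theorem eq_zero_of_pairing_self {x : Fin k → E} (h : pairing x x = 0) : x = 0 := by
  have h' := (Finset.sum_eq_zero_iff_of_nonneg (fun i _ => by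
    rw [inner_self_eq_norm_sq_to_K]
    positivity)).1 h
  ext i
  exact inner_self_eq_zero.1 (h' i (Finset.mem_univ i))

theorem pairing_act (M : CStarMatrix (Fin k) (Fin k) (E →L[ℂ] E)) (x y : Fin k → E) :
    pairing x (act M y) = ∑ i, ∑ j, ⟪x i, M i j (y j)⟫_ℂ := by
  simp only [pairing, act, inner_sum]

theorem eq_zero_of_act {M : CStarMatrix (Fin k) (Fin k) (E →L[ℂ] E)}
    (h : ∀ x, act M x = 0) : M = 0 := by
  ext i j y
  have := congrFun (h (Pi.single j y)) i
  simp only [act, Pi.zero_apply] at this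
  rw [Finset.sum_eq_single j (fun l _ hl => by simp [Pi.single_eq_of_ne hl]) (by simp)] at this
  simpa using this

variable [CompleteSpace E]

theorem pairing_act_star (M : CStarMatrix (Fin k) (Fin k) (E →L[ℂ] E)) (x y : Fin k → E) :
    pairing x (act (star M) y) = pairing (act M x) y := by
  rw [pairing_act, Finset.sum_comm]
  simp only [pairing, act, sum_inner, CStarMatrix.star_apply,
    ContinuousLinearMap.star_eq_adjoint, ContinuousLinearMap.adjoint_inner_right]

theorem pairing_act_nonneg {M : CStarMatrix (Fin k) (Fin k) (E →L[ℂ] E)} (hM : 0 ≤ M)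
    (x : Fin k → E) : 0 ≤ pairing x (act M x) := by
  obtain ⟨R, rfl⟩ := exists_eq_star_mul_self hM
  rw [act_mul, pairing_act_star]
  exact pairing_self_nonneg _

theorem act_eq_zero_of_pairing {M : CStarMatrix (Fin k) (Fin k) (E →L[ℂ] E)} (hM : 0 ≤ M)
    {x : Fin k → E} (hx : pairing x (act M x) = 0) : act M x = 0 := by
  obtain ⟨R, rfl⟩ := exists_eq_star_mul_self hM
  rw [act_mul, pairing_act_star] at hx
  rw [act_mul, eq_zero_of_pairing_self hx]
  ext i
  simp [act]

/-- Let `ρ` be a faithful representation. A self-adjoint matrix is nonnegative if its image under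
`ρ` has a nonnegative quadratic form. -/
theorem nonneg_of_pairing_act {S : Type*} [NonUnitalCStarAlgebra S] [PartialOrder S]
    [StarOrderedRing S] (ρ : S →⋆ₙₐ[ℂ] (E →L[ℂ] E)) (hρ : Function.Injective ρ)
    {M : CStarMatrix (Fin k) (Fin k) S} (hsa : IsSelfAdjoint M)
    (h : ∀ x, 0 ≤ pairing x (act (CStarMatrix.mapₙₐ ρ M) x)) : 0 ≤ M := by
  obtain ⟨P, N, hP0, hN0, rfl, hPN⟩ := exists_orthogonal_decomposition hsa
  set N' := CStarMatrix.mapₙₐ ρ N with hN'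
  have hN0' : 0 ≤ N' := map_nonneg (CStarMatrix.mapₙₐ ρ) hN0
  have hNsa : star N' = N' := star_eq_of_nonneg hN0'
  -- As `P N = 0`, compressing `P - N` by `N` leaves `-N³`. The form at vectors `N x` is then both
  -- nonnegative and nonpositive, which forces `N = 0`.
  have hMN : N' * (CStarMatrix.mapₙₐ ρ (P - N) * N') = - (N' * (N' * N')) := by
    rw [hN', ← map_mul, sub_mul, hPN, zero_sub, map_neg, map_mul, mul_neg]
  have hzero : ∀ x, act N' x = 0 := fun x => by
    have h1 := h (act N' x)
    have h2 := pairing_act_nonneg hN0' (act N' x)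
    have h3 : pairing (act N' x) (act (CStarMatrix.mapₙₐ ρ (P - N)) (act N' x)) =
        - pairing (act N' x) (act N' (act N' x)) := by
      rw [← act_mul, ← act_mul, ← pairing_act_star, ← pairing_act_star, hNsa, ← act_mul,
        ← act_mul, hMN, pairing_act, pairing_act]
      simp
    rw [h3] at h1
    have h4 := act_eq_zero_of_pairing hN0' (le_antisymm (neg_nonneg.1 h1) h2)
    refine eq_zero_of_pairing_self ?_
    rw [← pairing_act_star, hNsa, h4]
    simp [pairing]
  have hN : N = 0 := CStarMatrix.map_injective hρ <|
    (eq_zero_of_act hzero).trans (map_zero (CStarMatrix.mapₙₐ ρ)).symm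
  rwa [hN, sub_zero]

end MatrixAction

section CPMap

variable {S : Type*} [CStarAlgebra S] [PartialOrder S] [StarOrderedRing S]
variable {E : Type*} [NormedAddCommGroup E] [InnerProductSpace ℂ E]

/-- A nonnegative matrix is `R⋆ R`, a sum over the rows of `R` of Gram matrices, and `IsCP` applies
to each of these. -/
theorem IsCP.sum_map_nonneg {φ : S →ₗ[ℂ] (E →L[ℂ] E)} (hφ : IsCP φ) {k : ℕ}
    {M : CStarMatrix (Fin k) (Fin k) S} (hM : 0 ≤ M) (x : Fin k → E) :
    0 ≤ ∑ i, ∑ j, ⟪x i, φ (M i j) (x j)⟫_ℂ := by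
  obtain ⟨R, rfl⟩ := exists_eq_star_mul_self hM
  have h : ∑ i, ∑ j, ⟪x i, φ ((star R * R) i j) (x j)⟫_ℂ =
      ∑ l, ∑ i, ∑ j, ⟪x i, φ (star (R l i) * R l j) (x j)⟫_ℂ := by
    simp only [CStarMatrix.mul_apply, CStarMatrix.star_apply, map_sum, sum_apply, inner_sum]
    exact (Finset.sum_congr rfl fun i _ => Finset.sum_comm).trans Finset.sum_comm
  rw [h]
  exact Finset.sum_nonneg fun l _ => hφ k _ x

variable [CompleteSpace E]

theorem isCP_of_completelyPositiveMap (φ : CompletelyPositiveMap S (E →L[ℂ] E)) :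
    IsCP φ.toLinearMap := by
  rintro (_ | k) a x
  · simp
  -- With `a` as first row and zeros below, `R⋆ R` has entries `a_i⋆ a_j`.
  · let R : CStarMatrix (Fin (k + 1)) (Fin (k + 1)) S :=
      CStarMatrix.ofMatrix fun l i => if l = 0 then a i else 0
    have h := pairing_act_nonneg (φ.map_cstarMatrix_nonneg' _ _ (star_mul_self_nonneg R)) x
    rw [pairing_act] at h
    convert h using 6 with i _ j
    have hR : ∀ l i, R l i = if l = 0 then a i else 0 := fun _ _ => rfl
    rw [CStarMatrix.map_apply, CStarMatrix.mul_apply, Finset.sum_eq_single 0]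
    · simp [hR, CStarMatrix.star_apply]
    · intro l _ hl
      simp [hR, CStarMatrix.star_apply, hl]
    · simp

/-- The completely positive map given by a linear map with positive quadratic forms. -/
def IsCP.toCompletelyPositiveMap {φ : S →ₗ[ℂ] (E →L[ℂ] E)} (hφ : IsCP φ) :
    CompletelyPositiveMap S (E →L[ℂ] E) where
  toLinearMap := φ
  map_cstarMatrix_nonneg' k M hM := by
    refine nonneg_of_pairing_act (NonUnitalStarAlgHom.id ℂ _) Function.injective_id ?_ fun x => ?_
    · ext1 i j
      rw [CStarMatrix.star_apply, CStarMatrix.map_apply, CStarMatrix.map_apply, ← hφ.map_star,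
        ← CStarMatrix.star_apply, star_eq_of_nonneg hM]
    · rw [pairing_act]
      exact hφ.sum_map_nonneg hM x

end CPMap

section MatrixRange

variable {d : ℕ} {H : Type u} [NormedAddCommGroup H] [InnerProductSpace ℂ H] [CompleteSpace H]

theorem mem_matrixRange_iff {n : ℕ} {A : Fin d → H →L[ℂ] H} {X : Fin d → Mat n} :
    X ∈ matrixRange n A ↔ ∃ φ : cstar A →ₗ[ℂ] Mat n, IsCP φ ∧ φ 1 = 1 ∧
      ∀ i, φ (gen A i) = X i :=
  ⟨fun ⟨φ, h1, hX⟩ => ⟨φ.toLinearMap, isCP_of_completelyPositiveMap φ, h1, hX⟩,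
    fun ⟨_, hφ, h1, hX⟩ => ⟨hφ.toCompletelyPositiveMap,
      h1, hX⟩⟩

end MatrixRange

section Contractive

variable {S : Type*} [CStarAlgebra S] [PartialOrder S] [StarOrderedRing S]
variable {E : Type*} [NormedAddCommGroup E] [InnerProductSpace ℂ E]

theorem exists_star_mul_self_add_eq (a : S) :
    ∃ r : S, star a * a + star r * r = ((‖a‖ ^ 2 : ℝ) : ℂ) • (1 : S) := by
  have h : star a * a ≤ algebraMap ℝ S (‖a‖ ^ 2) := CStarAlgebra.star_mul_le_algebraMap_norm_sq
  obtain ⟨r, hr⟩ := exists_eq_star_mul_self (sub_nonneg.2 h)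
  refine ⟨r, ?_⟩
  rw [← hr, add_sub_cancel, Algebra.algebraMap_eq_smul_one, Complex.coe_smul]

theorem IsCP.norm_le {φ : S →ₗ[ℂ] (E →L[ℂ] E)} (hφ : IsCP φ) (h1 : φ 1 = 1) (a : S) :
    ‖φ a‖ ≤ ‖a‖ := by
  refine ContinuousLinearMap.opNorm_le_bound _ (norm_nonneg a) fun y => ?_
  obtain ⟨r, hr⟩ := exists_star_mul_self_add_eq a
  have h2 : 0 ≤ (⟪y, φ (star r * r) y⟫_ℂ).re := (Complex.nonneg_iff.1 (hφ.inner_nonneg r y)).1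
  have h3 : ((⟪y, φ (star a * a) y⟫_ℂ).re + (⟪y, φ (star r * r) y⟫_ℂ).re) =
      ‖a‖ ^ 2 * ‖y‖ ^ 2 := by
    rw [← Complex.add_re, ← inner_add_right, ← add_apply, ← map_add, hr,
      map_smul, h1, smul_apply, inner_smul_right, Complex.re_ofReal_mul,
      one_apply_eq_self, ← inner_self_eq_norm_sq (𝕜 := ℂ) y]
    rfl
  -- The pair `(-φ(a) y, y)` turns positivity into the Schwarz inequality `‖φ(a) y‖² ≤ ⟪y, φ(a⋆ a)
  -- y⟫`.
  have h4 := (Complex.nonneg_iff.1 (hφ.pair_nonneg a (-φ a y) y)).1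
  rw [h1, hφ.inner_star, one_apply_eq_self] at h4
  simp only [inner_neg_left, inner_neg_right, neg_neg, Complex.add_re, Complex.neg_re] at h4
  have h5 : (⟪φ a y, φ a y⟫_ℂ).re = ‖φ a y‖ ^ 2 := inner_self_eq_norm_sq (𝕜 := ℂ) _
  rw [h5] at h4
  refine le_of_sq_le_sq ?_ (by positivity)
  rw [mul_pow]
  linarith

end Contractive

/-! ### Krein and Arveson extension -/

section Extension

variable {H : Type*} [NormedAddCommGroup H] [InnerProductSpace ℂ H]
variable {n : ℕ}

/-- The quadratic form of a matrix of operators. -/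
def matrixForm (y : Fin n → Fin n → (H →L[ℂ] H)) (x : Fin n → H) : ℂ :=
  ∑ i, ∑ j, ⟪x i, y i j (x j)⟫_ℂ

theorem matrixForm_add (y z : Fin n → Fin n → (H →L[ℂ] H)) (x : Fin n → H) :
    matrixForm (y + z) x = matrixForm y x + matrixForm z x := by
  simp [matrixForm, Finset.sum_add_distrib]

theorem matrixForm_smul (c : ℂ) (y : Fin n → Fin n → (H →L[ℂ] H)) (x : Fin n → H) :
    matrixForm (c • y) x = c * matrixForm y x := by
  simp [matrixForm, Finset.mul_sum]

/-- The cone of accretive matrices of operators. -/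
def accretiveCone (H : Type*) [NormedAddCommGroup H] [InnerProductSpace ℂ H] (n : ℕ) :
    PointedCone ℝ (Fin n → Fin n → (H →L[ℂ] H)) where
  carrier := {y | ∀ x, 0 ≤ (matrixForm y x).re}
  add_mem' {y z} hy hz x := by
    rw [matrixForm_add, Complex.add_re]
    exact add_nonneg (hy x) (hz x)
  zero_mem' x := by simp [matrixForm]
  smul_mem' c y hy x := by
    have : c • y = ((c : ℝ) : ℂ) • y := by
      ext
      simp
    rw [this, matrixForm_smul, Complex.re_ofReal_mul]
    exact mul_nonneg c.2 (hy x)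

/-- Every matrix of operators becomes accretive after adding a multiple of the identity. -/
theorem exists_smul_one_add_mem (y : Fin n → Fin n → (H →L[ℂ] H)) :
    ∃ c : ℂ, (fun i j => if i = j then c • 1 else 0) + y ∈ accretiveCone H n := by
  -- The sum `c` of all entry norms suffices: the form of `y` is at most `c ∑ ‖x k‖²` in modulus.
  refine ⟨((∑ i, ∑ j, ‖y i j‖ : ℝ) : ℂ), fun x => ?_⟩
  set N : ℝ := ∑ k, ‖x k‖ ^ 2 with hN
  have hxN : ∀ i, ‖x i‖ ^ 2 ≤ N := fun i =>
    Finset.single_le_sum (f := fun k => ‖x k‖ ^ 2) (fun k _ => by positivity) (Finset.mem_univ i)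
  have h1 : matrixForm (fun i j => if i = j then
      ((∑ i, ∑ j, ‖y i j‖ : ℝ) : ℂ) • (1 : H →L[ℂ] H) else 0) x =
      (((∑ i, ∑ j, ‖y i j‖) * N : ℝ) : ℂ) := by
    have : ∀ i, ∑ j, ⟪x i, (if i = j then
        ((∑ i, ∑ j, ‖y i j‖ : ℝ) : ℂ) • (1 : H →L[ℂ] H) else 0) (x j)⟫_ℂ =
        (((∑ i, ∑ j, ‖y i j‖) * ‖x i‖ ^ 2 : ℝ) : ℂ) := fun i => by
      rw [Finset.sum_eq_single i (fun j _ hj => by simp [hj.symm]) (by simp), if_pos rfl,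
        smul_apply, inner_smul_right, one_apply_eq_self,
        inner_self_eq_norm_sq_to_K]
      push_cast
      rfl
    rw [matrixForm, Finset.sum_congr rfl fun i _ => this i, ← Complex.ofReal_sum,
      ← Finset.mul_sum]
  have h2 : ‖matrixForm y x‖ ≤ (∑ i, ∑ j, ‖y i j‖) * N := by
    rw [Finset.sum_mul]
    refine norm_sum_le_of_le _ fun i _ => ?_
    rw [Finset.sum_mul]
    refine norm_sum_le_of_le _ fun j _ => ?_
    calc ‖⟪x i, y i j (x j)⟫_ℂ‖ ≤ ‖x i‖ * (‖y i j‖ * ‖x j‖) :=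
          (norm_inner_le_norm _ _).trans (by gcongr; exact (y i j).le_opNorm _)
      _ = ‖y i j‖ * (‖x i‖ * ‖x j‖) := by ring
      _ ≤ ‖y i j‖ * N := by
          gcongr
          nlinarith [hxN i, hxN j, sq_nonneg (‖x i‖ - ‖x j‖)]
  rw [matrixForm_add, h1, Complex.add_re, Complex.ofReal_re]
  have := (abs_le.1 ((Complex.abs_re_le_norm _).trans h2)).1
  linarith

variable [CompleteSpace H]

theorem matrixForm_star_mul (r : Fin n → (H →L[ℂ] H)) (x : Fin n → H) :
    matrixForm (fun i j => star (r i) * r j) x = ((‖∑ j, r j (x j)‖ ^ 2 : ℝ) : ℂ) := by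
  have h : ((‖∑ j, r j (x j)‖ ^ 2 : ℝ) : ℂ) = ⟪∑ j, r j (x j), ∑ j, r j (x j)⟫_ℂ := by
    rw [inner_self_eq_norm_sq_to_K]
    push_cast
    rfl
  rw [h, sum_inner]
  simp [matrixForm, inner_sum, ContinuousLinearMap.star_eq_adjoint,
    ContinuousLinearMap.adjoint_inner_right]

variable {S : Type*} [CStarAlgebra S] [PartialOrder S] [StarOrderedRing S]
variable {E : Type*} [NormedAddCommGroup E] [InnerProductSpace ℂ E]

/-- Accretivity of the image says that `M + M⋆` is nonnegative, since `ρ` is faithful; the `φ`-form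
of `M + M⋆` is twice the real part in question. -/
theorem re_sum_nonneg_of_mem_accretiveCone (ρ : S →⋆ₐ[ℂ] (H →L[ℂ] H))
    (hρ : Function.Injective ρ) {φ : S →ₗ[ℂ] (E →L[ℂ] E)} (hφ : IsCP φ) (m : Fin n → Fin n → S)
    (hm : (fun i j => ρ (m i j)) ∈ accretiveCone H n) (x : Fin n → E) :
    0 ≤ (∑ i, ∑ j, ⟪x i, φ (m i j) (x j)⟫_ℂ).re := by
  let M : CStarMatrix (Fin n) (Fin n) S := CStarMatrix.ofMatrix m
  have hM : ∀ i j, (M + star M) i j = m i j + star (m j i) := fun _ _ => rfl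
  have h0 : 0 ≤ M + star M := by
    refine nonneg_of_pairing_act (ρ : S →⋆ₙₐ[ℂ] (H →L[ℂ] H)) hρ (IsSelfAdjoint.add_star_self M)
      fun z => ?_
    have h1 : pairing z (act (CStarMatrix.mapₙₐ (ρ : S →⋆ₙₐ[ℂ] (H →L[ℂ] H)) (M + star M)) z) =
        matrixForm (fun i j => ρ (m i j)) z + conj (matrixForm (fun i j => ρ (m i j)) z) := by
      have h2 : ∀ i j, CStarMatrix.mapₙₐ (ρ : S →⋆ₙₐ[ℂ] (H →L[ℂ] H)) (M + star M) i j =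
          ρ (m i j) + star (ρ (m j i)) := fun i j => by
        rw [← map_star, ← map_add]
        rfl
      rw [pairing_act]
      simp only [h2, add_apply, inner_add_right, Finset.sum_add_distrib,
        matrixForm, map_sum, inner_conj_symm, ContinuousLinearMap.star_eq_adjoint,
        ContinuousLinearMap.adjoint_inner_right]
      congr 1
      exact Finset.sum_comm
    rw [h1, Complex.add_conj, Complex.zero_le_real]
    have := hm z
    positivity
  have h3 := (Complex.nonneg_iff.1 (hφ.sum_map_nonneg h0 x)).1
  have h4 : ∑ i, ∑ j, ⟪x i, φ ((M + star M) i j) (x j)⟫_ℂ =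
      ∑ i, ∑ j, ⟪x i, φ (m i j) (x j)⟫_ℂ + conj (∑ i, ∑ j, ⟪x i, φ (m i j) (x j)⟫_ℂ) := by
    simp only [hM, map_add, add_apply, inner_add_right,
      Finset.sum_add_distrib, map_sum, inner_conj_symm, hφ.inner_star]
    congr 1
    exact Finset.sum_comm
  rw [h4, Complex.add_conj, Complex.ofReal_re] at h3
  linarith

/-- Krein's extension theorem for matrices: the functional on matrices over `S` induced by a
completely positive map extends to matrices over `B(H)`, positively on Gram matrices. -/
theorem exists_functional_extension (ρ : S →⋆ₐ[ℂ] (H →L[ℂ] H))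
    (hρ : Function.Injective ρ) {φ : S →ₗ[ℂ] (E →L[ℂ] E)} (hφ : IsCP φ) (x : Fin n → E) :
    ∃ F : (Fin n → Fin n → (H →L[ℂ] H)) →ₗ[ℂ] ℂ,
      (∀ m : Fin n → Fin n → S, F (fun i j => ρ (m i j)) = ∑ i, ∑ j, ⟪x i, φ (m i j) (x j)⟫_ℂ) ∧
      ∀ r : Fin n → (H →L[ℂ] H), 0 ≤ F (fun i j => star (r i) * r j) := by
  let inc : (Fin n → Fin n → S) →ₗ[ℝ] (Fin n → Fin n → (H →L[ℂ] H)) :=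
    { toFun := fun m i j => ρ (m i j)
      map_add' := fun _ _ => by ext; simp
      map_smul' := fun c m => by
        ext i j
        simp [← Complex.coe_smul] }
  have hinc : Function.Injective inc := fun m m' h => by
    ext i j
    exact hρ (congrFun (congrFun h i) j)
  let g : (Fin n → Fin n → S) →ₗ[ℝ] ℝ :=
    { toFun := fun m => (∑ i, ∑ j, ⟪x i, φ (m i j) (x j)⟫_ℂ).re
      map_add' := fun _ _ => by simp [Finset.sum_add_distrib]
      map_smul' := fun c m => by
        simp [← Complex.coe_smul, Finset.mul_sum] }
  let e := LinearEquiv.ofInjective inc hinc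
  let f : (Fin n → Fin n → (H →L[ℂ] H)) →ₗ.[ℝ] ℝ :=
    ⟨LinearMap.range inc, g ∘ₗ e.symm.toLinearMap⟩
  -- Accretive rather than positive matrices are used so that the cone lives in the whole real
  -- vector space; scalar matrices, which come from `S`, supply the cofinality that the extension
  -- needs.
  obtain ⟨G, hGf, hG0⟩ := riesz_extension (accretiveCone H n) f
    (by
      rintro ⟨_, m, rfl⟩ hm
      have : e.symm ⟨inc m, m, rfl⟩ = m := e.symm_apply_apply m
      change 0 ≤ g (e.symm ⟨inc m, m, rfl⟩)
      rw [this]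
      exact re_sum_nonneg_of_mem_accretiveCone ρ hρ hφ m hm x)
    (by
      intro y
      obtain ⟨c, hc⟩ := exists_smul_one_add_mem y
      refine ⟨⟨_, fun i j => if i = j then c • 1 else 0, rfl⟩, ?_⟩
      convert hc using 1
      congr 1
      ext i j : 2
      change ρ (if i = j then c • 1 else 0) = _
      split_ifs <;> simp)
  have hG : ∀ m : Fin n → Fin n → S, G (fun i j => ρ (m i j)) = g m := fun m => by
    have : e.symm ⟨inc m, m, rfl⟩ = m := e.symm_apply_apply m
    refine (hGf ⟨inc m, m, rfl⟩).trans ?_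
    change g (e.symm ⟨inc m, m, rfl⟩) = _
    rw [this]
  let F : Module.Dual ℂ (Fin n → Fin n → (H →L[ℂ] H)) := Module.Dual.extendRCLike G
  have hre : ∀ y, (F y).re = G y := fun y => Module.Dual.re_extendRCLike_apply (𝕜 := ℂ) G y
  have him : ∀ y, (F y).im = - G (Complex.I • y) := fun y => by
    rw [← hre, map_smul]
    simp
  refine ⟨F, fun m => Complex.ext ?_ ?_, fun r => Complex.nonneg_iff.2 ⟨?_, ?_⟩⟩
  · rw [hre, hG]
    rfl
  · have h : (Complex.I • fun i j => ρ (m i j)) = fun i j => ρ ((Complex.I • m) i j) := by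
      ext i j : 2
      simp
    rw [him, h, hG]
    simp [g]
  · rw [hre]
    refine hG0 _ fun z => ?_
    rw [matrixForm_star_mul, Complex.ofReal_re]
    positivity
  -- Both `i` and `-i` times a Gram matrix have a form with zero real part, so both lie in the cone
  -- and the imaginary part of `F` vanishes.
  · have hI : ∀ c : ℂ, c.re = 0 → 0 ≤ G (c • fun i j => star (r i) * r j) := fun c hc => by
      refine hG0 _ fun z => ?_
      rw [matrixForm_smul, matrixForm_star_mul, Complex.re_mul_ofReal, hc, zero_mul]
    have h1 := hI Complex.I Complex.I_re
    have h2 := hI (-Complex.I) (by simp)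
    rw [neg_smul, map_neg] at h2
    rw [him]
    linarith

theorem sum_comm_pairs {ι κ : Type*} [Fintype ι] [Fintype κ] (f : κ → κ → ι → ι → ℂ) :
    ∑ p, ∑ q, ∑ i, ∑ j, f p q i j = ∑ i, ∑ j, ∑ p, ∑ q, f p q i j := by
  simp only [← Fintype.sum_prod_type' (f := fun p q => f p q _ _),
    ← Fintype.sum_prod_type' (f := fun i j => ∑ x : κ × κ, f x.1 x.2 i j)]
  rw [← Fintype.sum_prod_type' (f := fun p q => ∑ i, ∑ j, f p q i j)]
  simp only [← Fintype.sum_prod_type' (f := fun i j => f _ _ i j)]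
  exact Finset.sum_comm

/-- Arveson's extension theorem for maps into operators on a finite-dimensional space. -/
theorem IsCP.exists_extension (ρ : S →⋆ₐ[ℂ] (H →L[ℂ] H)) (hρ : Function.Injective ρ)
    {φ : S →ₗ[ℂ] (E →L[ℂ] E)} (hφ : IsCP φ) (b : OrthonormalBasis (Fin n) ℂ E) :
    ∃ Φ : (H →L[ℂ] H) →ₗ[ℂ] (E →L[ℂ] E), IsCP Φ ∧ ∀ s, Φ (ρ s) = φ s := by
  obtain ⟨F, hF, hF0⟩ := exists_functional_extension ρ hρ hφ b
  let sgl (i j : Fin n) : (H →L[ℂ] H) →ₗ[ℂ] (Fin n → Fin n → (H →L[ℂ] H)) :=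
    LinearMap.single ℂ _ i ∘ₗ LinearMap.single ℂ (fun _ : Fin n => (H →L[ℂ] H)) j
  have hsgl : ∀ y : Fin n → Fin n → (H →L[ℂ] H), y = ∑ i, ∑ j, sgl i j (y i j) := fun y => by
    ext i j : 2
    rw [Finset.sum_apply, Finset.sum_apply, Finset.sum_eq_single i, Finset.sum_apply,
      Finset.sum_apply, Finset.sum_eq_single j]
    · simp [sgl]
    · intro j' _ hj
      simp [sgl, hj.symm]
    · simp
    · intro i' _ hi
      simp [sgl, hi.symm]
    · simp
  -- The `(i, j)` coefficient of `Φ T` in the basis `b` is `F` at the matrix with `T` in position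
  -- `(i, j)`.
  let Φ : (H →L[ℂ] H) →ₗ[ℂ] (E →L[ℂ] E) :=
    ∑ i, ∑ j, (F ∘ₗ sgl i j).smulRight (InnerProductSpace.rankOne ℂ (b i) (b j))
  have hΦ : ∀ T u v, ⟪u, Φ T v⟫_ℂ = ∑ i, ∑ j, ⟪u, b i⟫_ℂ * F (sgl i j T) * ⟪b j, v⟫_ℂ := by
    intro T u v
    simp only [Φ, LinearMap.sum_apply, sum_apply, inner_sum, LinearMap.smulRight_apply,
      smul_apply, InnerProductSpace.rankOne_apply, inner_smul_right,
      LinearMap.comp_apply]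
    refine Finset.sum_congr rfl fun i _ => Finset.sum_congr rfl fun j _ => by ring
  refine ⟨Φ, fun k a x => ?_, fun s => ?_⟩
  -- Expanding the vectors `x l` in `b` makes the quadratic form of `Φ` the value of `F` at the Gram
  -- matrix of `r`.
  · let r : Fin n → (H →L[ℂ] H) := fun j => ∑ l, ⟪b j, x l⟫_ℂ • a l
    have h : ∑ p, ∑ q, ⟪x p, Φ (star (a p) * a q) (x q)⟫_ℂ =
        F (fun i j => star (r i) * r j) := by
      have hr : ∀ i j, star (r i) * r j =
          ∑ p, ∑ q, (⟪x p, b i⟫_ℂ * ⟪b j, x q⟫_ℂ) • (star (a p) * a q) := fun i j => by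
        simp only [r, star_sum, star_smul, Finset.sum_mul_sum, smul_mul_smul_comm,
          RCLike.star_def, inner_conj_symm]
      rw [hsgl fun i j => star (r i) * r j]
      simp only [hΦ, hr, map_sum, map_smul, smul_eq_mul]
      rw [sum_comm_pairs]
      refine Finset.sum_congr rfl fun i _ => Finset.sum_congr rfl fun j _ =>
        Finset.sum_congr rfl fun p _ => Finset.sum_congr rfl fun q _ => by ring
    rw [h]
    exact hF0 r
  · have hs : ∀ i j, F (sgl i j (ρ s)) = ⟪b i, φ s (b j)⟫_ℂ := fun i j => by
      have h : sgl i j (ρ s) =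
          fun i' j' => ρ ((Pi.single i (Pi.single j s) : Fin n → Fin n → S) i' j') := by
        ext i' j' : 2
        rcases eq_or_ne i i' with rfl | hi
        · rcases eq_or_ne j j' with rfl | hj
          · simp [sgl]
          · simp [sgl, hj]
        · simp [sgl, hi]
      rw [h, hF, Finset.sum_eq_single i, Finset.sum_eq_single j]
      · simp
      · intro j' _ hj
        simp [hj]
      · simp
      · intro i' _ hi
        simp [hi]
      · simp
    ext v
    refine ext_inner_left ℂ fun u => ?_
    rw [hΦ, ← b.sum_inner_mul_inner u (φ s v)]
    refine Finset.sum_congr rfl fun i _ => ?_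
    conv_rhs => rw [← b.sum_repr' v]
    simp only [hs, map_sum, map_smul, inner_sum, inner_smul_right, Finset.mul_sum]
    exact Finset.sum_congr rfl fun j _ => by ring

end Extension

/-! ### Stinespring dilation on a reproducing kernel space -/

section ReproducingKernel

variable {X : Type*} {H : Type*} [NormedAddCommGroup H] [InnerProductSpace ℂ H] [CompleteSpace H]
variable {L : Type*} [NormedAddCommGroup L] [InnerProductSpace ℂ L] [CompleteSpace L]
  [RKHS ℂ L X H]

theorem ext_of_inner_kerFun {f g : L}
    (h : ∀ b w, ⟪RKHS.kerFun L b w, f⟫_ℂ = ⟪RKHS.kerFun L b w, g⟫_ℂ) : f = g :=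
  RKHS.ext fun b => ext_inner_left ℂ fun w => by
    rw [← RKHS.kerFun_inner, ← RKHS.kerFun_inner, h]

theorem ext_of_kerFun {T T' : L →L[ℂ] L}
    (h : ∀ b v, T (RKHS.kerFun L b v) = T' (RKHS.kerFun L b v)) : T = T' := by
  refine star_injective (ContinuousLinearMap.ext fun f => ext_of_inner_kerFun fun b w => ?_)
  rw [ContinuousLinearMap.star_eq_adjoint,
    ContinuousLinearMap.star_eq_adjoint, ContinuousLinearMap.adjoint_inner_right,
    ContinuousLinearMap.adjoint_inner_right, h]

end ReproducingKernel

section Stinespring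

variable {S : Type u} [CStarAlgebra S]
variable {H : Type u} [NormedAddCommGroup H] [InnerProductSpace ℂ H] [CompleteSpace H]

/-- The operator-valued kernel `(a, b) ↦ ψ (a⋆ b)` of a linear map `ψ`. -/
def kernelOf (ψ : S →ₗ[ℂ] (H →L[ℂ] H)) : Matrix S S (H →L[ℂ] H) :=
  Matrix.of fun a b => ψ (star a * b)

theorem IsCP.posSemidef_kernelOf {ψ : S →ₗ[ℂ] (H →L[ℂ] H)} (hψ : IsCP ψ) :
    (kernelOf ψ).PosSemidef := by
  apply (RKHS.posSemidef_tfae.out 0 2).2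
  refine ⟨?_, fun v => ?_⟩
  · ext1 a b
    rw [Matrix.conjTranspose_apply, kernelOf, Matrix.of_apply, Matrix.of_apply, ← hψ.map_star]
    simp
  · have h := hψ.sum_nonneg (fun i : v.support => (i : S)) (fun i : v.support => v i)
    have h' : (v.sum fun x w => v.sum fun x' w' => ⟪kernelOf ψ x' x w, w'⟫_ℂ) =
        conj (∑ i : v.support, ∑ j : v.support, ⟪v i, ψ (star (i : S) * j) (v j)⟫_ℂ) := by
      simp only [map_sum, inner_conj_symm]
      rw [Finset.sum_comm]
      simp only [Finsupp.sum, kernelOf, Matrix.of_apply]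
      rw [← Finset.sum_coe_sort]
      refine Finset.sum_congr rfl fun i _ => ?_
      rw [← Finset.sum_coe_sort]
    rw [h']
    exact (Complex.nonneg_iff.1 h).1

variable {L : Type u} [NormedAddCommGroup L] [InnerProductSpace ℂ L] [CompleteSpace L]
  [RKHS ℂ L S H]

variable (L) in
/-- The combination `∑ z • k (c * b) v` of kernel functions given by coefficients `z` at `(b, v)`. -/
def kerComb (c : S) : (S × H →₀ ℂ) →ₗ[ℂ] L :=
  Finsupp.linearCombination ℂ fun p : S × H => RKHS.kerFun L (c * p.1) p.2

theorem denseRange_kerComb_one : DenseRange (kerComb L (1 : S)) := by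
  have h := RKHS.kerFun_dense (𝕜 := ℂ) L
  rw [← Submodule.dense_iff_topologicalClosure_eq_top] at h
  refine h.mono (Submodule.span_le (p := LinearMap.range (kerComb L (1 : S))).2 ?_)
  rintro _ ⟨b, v, rfl⟩
  exact ⟨Finsupp.single (b, v) 1, by simp [kerComb]⟩

theorem inner_kerFun_kerFun {ψ : S →ₗ[ℂ] (H →L[ℂ] H)} (hL : RKHS.kernel L = kernelOf ψ)
    (a b : S) (v w : H) :
    ⟪RKHS.kerFun L a v, RKHS.kerFun L b w⟫_ℂ = ⟪v, ψ (star a * b) w⟫_ℂ := by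
  rw [RKHS.kerFun_inner, RKHS.kerFun_apply, hL, kernelOf, Matrix.of_apply]

theorem inner_kerComb {ψ : S →ₗ[ℂ] (H →L[ℂ] H)} (hL : RKHS.kernel L = kernelOf ψ)
    (c : S) (f g : S × H →₀ ℂ) :
    ⟪kerComb L c f, kerComb L c g⟫_ℂ = f.sum fun p z => g.sum fun q w =>
      conj z * w * ⟪p.2, ψ (star p.1 * (star c * c) * q.1) q.2⟫_ℂ := by
  simp only [kerComb, Finsupp.linearCombination_apply, Finsupp.sum_inner, Finsupp.inner_sum,
    inner_smul_left, inner_smul_right, inner_kerFun_kerFun hL, star_mul, mul_assoc]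
  rw [Finsupp.sum_comm]
  simp only [Finsupp.mul_sum, mul_left_comm]

/-- Pairing with kernel functions evaluates at points. This is what makes the representation by left
multiplications star-preserving. -/
theorem adjoint_shift_apply {c : S} {T : L →L[ℂ] L}
    (hT : ∀ b v, T (RKHS.kerFun L b v) = RKHS.kerFun L (c * b) v) (f : L) (a : S) :
    star T f a = f (c * a) := by
  refine ext_inner_left ℂ fun v => ?_
  rw [← RKHS.kerFun_inner, ContinuousLinearMap.star_eq_adjoint,
    ContinuousLinearMap.adjoint_inner_right, hT, RKHS.kerFun_inner]

variable [PartialOrder S] [StarOrderedRing S]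

/-- Write `‖c‖² - c⋆ c = r⋆ r`: the squared norms for `c` and `r` add up to `‖c‖²` times the one for
`1`. Hence left multiplication by `c` is well defined and bounded on the span of the kernel
functions. -/
theorem norm_kerComb_le {ψ : S →ₗ[ℂ] (H →L[ℂ] H)} (hL : RKHS.kernel L = kernelOf ψ)
    (c : S) (f : S × H →₀ ℂ) : ‖kerComb L c f‖ ≤ ‖c‖ * ‖kerComb L 1 f‖ := by
  obtain ⟨r, hr⟩ := exists_star_mul_self_add_eq c
  have h : ⟪kerComb L c f, kerComb L c f⟫_ℂ + ⟪kerComb L r f, kerComb L r f⟫_ℂ =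
      ((‖c‖ ^ 2 : ℝ) : ℂ) * ⟪kerComb L 1 f, kerComb L 1 f⟫_ℂ := by
    rw [inner_kerComb hL, inner_kerComb hL, inner_kerComb hL, ← Finsupp.sum_add, Finsupp.mul_sum]
    refine Finsupp.sum_congr fun p _ => ?_
    rw [← Finsupp.sum_add, Finsupp.mul_sum]
    refine Finsupp.sum_congr fun q _ => ?_
    rw [← mul_add, ← inner_add_right, ← add_apply, ← map_add, ← add_mul, ← mul_add, hr]
    simp only [star_one, mul_one, mul_smul_comm, smul_mul_assoc, map_smul, smul_apply,
      inner_smul_right]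
    ring
  rw [inner_self_eq_norm_sq_to_K, inner_self_eq_norm_sq_to_K, inner_self_eq_norm_sq_to_K] at h
  have h' : ‖kerComb L c f‖ ^ 2 + ‖kerComb L r f‖ ^ 2 = ‖c‖ ^ 2 * ‖kerComb L 1 f‖ ^ 2 := by
    simp only [Complex.coe_algebraMap] at h
    exact_mod_cast h
  refine le_of_sq_le_sq ?_ (by positivity)
  rw [mul_pow]
  nlinarith [sq_nonneg ‖kerComb L r f‖]

theorem exists_shift {ψ : S →ₗ[ℂ] (H →L[ℂ] H)} (hL : RKHS.kernel L = kernelOf ψ) (c : S) :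
    ∃ T : L →L[ℂ] L, ∀ b v, T (RKHS.kerFun L b v) = RKHS.kerFun L (c * b) v := by
  refine ⟨(kerComb L c).extendOfNorm (kerComb L 1), fun b v => ?_⟩
  have h := (kerComb L c).extendOfNorm_eq denseRange_kerComb_one ⟨‖c‖, norm_kerComb_le hL c⟩
    (Finsupp.single (b, v) 1)
  simpa [kerComb] using h
/-- Left multiplication of `S` on the space of the kernel `(a, b) ↦ ψ (a⋆ b)`. -/
theorem exists_representation {ψ : S →ₗ[ℂ] (H →L[ℂ] H)} (hL : RKHS.kernel L = kernelOf ψ) :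
    ∃ π : S →⋆ₐ[ℂ] (L →L[ℂ] L), ∀ c b v, π c (RKHS.kerFun L b v) = RKHS.kerFun L (c * b) v := by
  choose T hT using exists_shift (L := L) hL
  have hadd : ∀ (a b : S) (v : H),
      RKHS.kerFun L (a + b) v = RKHS.kerFun L a v + RKHS.kerFun L b v :=
    fun a b v => ext_of_inner_kerFun fun c w => by
      simp only [inner_add_right, inner_kerFun_kerFun hL, mul_add, map_add, add_apply]
  have hsmul : ∀ (z : ℂ) (a : S) (v : H), RKHS.kerFun L (z • a) v = z • RKHS.kerFun L a v :=
    fun z a v => ext_of_inner_kerFun fun c w => by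
      simp only [inner_smul_right, inner_kerFun_kerFun hL, mul_smul_comm, map_smul, smul_apply]
  have hTone : T 1 = 1 := ext_of_kerFun fun b v => by rw [hT, one_mul, one_apply_eq_self]
  have hTsmul : ∀ (z : ℂ) (a : S), T (z • a) = z • T a := fun z a =>
    ext_of_kerFun fun b v => by rw [hT, smul_apply, hT, smul_mul_assoc, hsmul]
  refine ⟨
    { toFun := T
      map_one' := hTone
      map_mul' := fun a b => ext_of_kerFun fun c v => by
        rw [mul_apply_eq_comp, hT, hT, hT, mul_assoc]
      map_zero' := by simpa using hTsmul 0 0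
      map_add' := fun a b => ext_of_kerFun fun c v => by
        rw [add_apply, hT, hT, hT, add_mul, hadd]
      commutes' := fun z => by
        rw [Algebra.algebraMap_eq_smul_one, Algebra.algebraMap_eq_smul_one, hTsmul, hTone]
      map_star' := fun a => ext_of_kerFun fun c v => RKHS.ext fun b => by
        rw [hT, adjoint_shift_apply (hT a), RKHS.kerFun_apply, RKHS.kerFun_apply, hL]
        simp [kernelOf, mul_assoc] }, hT⟩

/-- Stinespring's dilation theorem for unital completely positive maps. -/
theorem IsCP.exists_dilation {ψ : S →ₗ[ℂ] (H →L[ℂ] H)} (hψ : IsCP ψ) (h1 : ψ 1 = 1) :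
    ∃ (L : Type u) (_ : NormedAddCommGroup L) (_ : InnerProductSpace ℂ L) (_ : CompleteSpace L)
      (π : S →⋆ₐ[ℂ] (L →L[ℂ] L)) (V : H →ₗᵢ[ℂ] L),
      ∀ a x y, ⟪V x, π a (V y)⟫_ℂ = ⟪x, ψ a y⟫_ℂ := by
  have : Fact (kernelOf ψ).PosSemidef := ⟨hψ.posSemidef_kernelOf⟩
  have hL : RKHS.kernel (RKHS.OfKernel (kernelOf ψ)) = kernelOf ψ := RKHS.OfKernel.kernel_ofKernel
  obtain ⟨π, hπ⟩ := exists_representation hL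
  -- The kernel function at `a` applied to `v` plays the role of `a ⊗ v`; `V` sends `x` to `1 ⊗ x`,
  -- which is isometric because `ψ 1 = 1`.
  refine ⟨RKHS.OfKernel (kernelOf ψ), inferInstance, inferInstance, inferInstance, π,
    (RKHS.kerFun (RKHS.OfKernel (kernelOf ψ)) (1 : S)).toLinearMap.isometryOfInner fun x y => ?_,
    fun a x y => ?_⟩
  · exact (inner_kerFun_kerFun hL 1 1 x y).trans (by simp [h1])
  · refine Eq.trans (congrArg _ (hπ a 1 y)) ((inner_kerFun_kerFun hL 1 (a * 1) x y).trans ?_)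
    simp

end Stinespring

/-! ### Compositions, compressions and representations -/

section Operations

variable {E : Type*} [NormedAddCommGroup E] [InnerProductSpace ℂ E] [CompleteSpace E]
variable {E' : Type*} [NormedAddCommGroup E'] [InnerProductSpace ℂ E']

theorem IsCP.comp {S : Type*} [CStarAlgebra S] [PartialOrder S] [StarOrderedRing S]
    {Φ : (E →L[ℂ] E) →ₗ[ℂ] (E' →L[ℂ] E')} (hΦ : IsCP Φ) {φ : S →ₗ[ℂ] (E →L[ℂ] E)} (hφ : IsCP φ) :
    IsCP (Φ ∘ₗ φ) := by
  intro k a x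
  let M : CStarMatrix (Fin k) (Fin k) (E →L[ℂ] E) :=
    CStarMatrix.ofMatrix fun i j => φ (star (a i) * a j)
  have hM : ∀ i j, M i j = φ (star (a i) * a j) := fun _ _ => rfl
  refine hΦ.sum_map_nonneg (M := M) ?_ x
  refine nonneg_of_pairing_act (NonUnitalStarAlgHom.id ℂ _) Function.injective_id ?_ fun y => ?_
  · ext1 i j
    rw [CStarMatrix.star_apply, hM, hM, ← hφ.map_star]
    simp
  · rw [pairing_act]
    exact hφ k a y

variable [CompleteSpace E']

/-- The compression `T ↦ J⋆ T J` by a bounded operator `J`. -/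
def compress (J : E →L[ℂ] E') : (E' →L[ℂ] E') →ₗ[ℂ] (E →L[ℂ] E) where
  toFun T := J.adjoint ∘L T ∘L J
  map_add' _ _ := by ext; simp
  map_smul' _ _ := by ext; simp

theorem inner_compress (J : E →L[ℂ] E') (T : E' →L[ℂ] E') (x y : E) :
    ⟪x, compress J T y⟫_ℂ = ⟪J x, T (J y)⟫_ℂ :=
  ContinuousLinearMap.adjoint_inner_right J x (T (J y))

theorem isCP_compress (J : E →L[ℂ] E') : IsCP (compress J) := by
  intro k a x
  simp only [inner_compress]
  have := matrixForm_star_mul a (fun i => J (x i))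
  rw [matrixForm] at this
  rw [this, Complex.zero_le_real]
  positivity

theorem compress_one (J : E →ₗᵢ[ℂ] E') : compress J.toContinuousLinearMap 1 = 1 := by
  ext y
  refine ext_inner_left ℂ fun x => ?_
  rw [inner_compress]
  exact J.inner_map_map x y

theorem isCP_starAlgHom {S : Type*} [Ring S] [StarRing S] [Algebra ℂ S]
    (ρ : S →⋆ₐ[ℂ] (E →L[ℂ] E)) : IsCP ρ.toAlgHom.toLinearMap := by
  intro k a x
  have h := matrixForm_star_mul (fun i => ρ (a i)) x
  have h' : matrixForm (fun i j => star (ρ (a i)) * ρ (a j)) x =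
      ∑ i, ∑ j, ⟪x i, ρ.toAlgHom.toLinearMap (star (a i) * a j) (x j)⟫_ℂ := by
    refine Finset.sum_congr rfl fun i _ => Finset.sum_congr rfl fun j _ => ?_
    simp only [← map_star, ← map_mul]
    rfl
  rw [← h', h, Complex.zero_le_real]
  positivity

end Operations

/-! ### Equivalence of tuples through faithful representations -/

section Equivalence

variable {d : ℕ}
variable {H : Type u} [NormedAddCommGroup H] [InnerProductSpace ℂ H] [CompleteSpace H]
variable {K : Type u} [NormedAddCommGroup K] [InnerProductSpace ℂ K] [CompleteSpace K]

/-- A closed *-subalgebra of `C*(A)` that contains the generators is all of `C*(A)`. -/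
theorem mem_of_gen_mem {A : Fin d → H →L[ℂ] H} {T : StarSubalgebra ℂ (cstar A)}
    (hT : IsClosed (T : Set (cstar A))) (h : ∀ i, gen A i ∈ T) (s : cstar A) : s ∈ T := by
  have hcl : IsClosed ((T.map (cstar A).subtype : StarSubalgebra ℂ (H →L[ℂ] H)) :
      Set (H →L[ℂ] H)) := by
    rw [StarSubalgebra.coe_map]
    exact ((isClosed_cstar A).isClosedEmbedding_subtypeVal).isClosedMap _ hT
  have hle : cstar A ≤ T.map (cstar A).subtype := by
    refine StarSubalgebra.topologicalClosure_minimal (StarAlgebra.adjoin_le ?_) hcl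
    rintro _ ⟨i, rfl⟩
    exact ⟨gen A i, h i, rfl⟩
  obtain ⟨t, ht, hts⟩ := hle s.2
  rwa [← Subtype.ext (a1 := t) (a2 := s) hts]

/-- A faithful representation of `C*(A)` maps `A` to an equivalent tuple. -/
theorem equivalent_of_injective {A : Fin d → H →L[ℂ] H} {B : Fin d → K →L[ℂ] K}
    (ρ : cstar A →⋆ₐ[ℂ] (K →L[ℂ] K)) (hρ : Function.Injective ρ) (h : ∀ i, ρ (gen A i) = B i) :
    Equivalent A B := by
  -- An injective *-homomorphism is isometric, so its range is closed and is exactly the C*-algebra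
  -- generated by the `B i`.
  have hiso : Isometry ρ := NonUnitalStarAlgHom.isometry ρ hρ
  have hrange : ρ.range = cstar B := by
    refine le_antisymm ?_ ?_
    · rintro _ ⟨s, rfl⟩
      refine mem_of_gen_mem (T := (cstar B).comap ρ) ?_ (fun i => ?_) s
      · exact (isClosed_cstar B).preimage hiso.continuous
      · change ρ (gen A i) ∈ cstar B
        rw [h]
        exact (gen B i).2
    · refine StarSubalgebra.topologicalClosure_minimal (StarAlgebra.adjoin_le ?_) ?_
      · rintro _ ⟨i, rfl⟩
        exact ⟨gen A i, h i⟩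
      · exact hiso.isClosedEmbedding.isClosed_range
  have hmem : ∀ s, ρ s ∈ cstar B := fun s => hrange ▸ ⟨s, rfl⟩
  refine ⟨StarAlgEquiv.ofBijective (ρ.codRestrict (cstar B) hmem) ⟨?_, ?_⟩, fun i => ?_⟩
  · exact (StarAlgHom.injective_codRestrict ρ _ hmem).2 hρ
  · rintro ⟨b, hb⟩
    rw [← hrange] at hb
    obtain ⟨s, rfl⟩ := hb
    exact ⟨s, rfl⟩
  · exact Subtype.ext (h i)

theorem Equivalent.exists_faithful {A : Fin d → H →L[ℂ] H} {B : Fin d → K →L[ℂ] K}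
    (h : Equivalent A B) : ∃ ρ : cstar A →⋆ₐ[ℂ] (K →L[ℂ] K), Function.Injective ρ ∧
      ∀ i, ρ (gen A i) = B i := by
  obtain ⟨φ, hφ⟩ := h
  refine ⟨(cstar B).subtype.comp (φ : cstar A →⋆ₐ[ℂ] cstar B), ?_, fun i => ?_⟩
  · exact Subtype.val_injective.comp φ.injective
  · exact congrArg Subtype.val (hφ i)

theorem Equivalent.refl (A : Fin d → H →L[ℂ] H) : Equivalent A A :=
  ⟨StarAlgEquiv.refl ℂ _, fun _ => rfl⟩

end Equivalence

/-! ### The matrix range distance is at most the relaxed dilation distance -/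

section LowerBound

variable {d : ℕ}
variable {H : Type u} [NormedAddCommGroup H] [InnerProductSpace ℂ H] [CompleteSpace H]
variable {K : Type u} [NormedAddCommGroup K] [InnerProductSpace ℂ K] [CompleteSpace K]

/-- Arveson's theorem along the embedding of C*(A) in B(K). Since `Φ` lives on all of B(K), it can
also be evaluated at tuples outside C*(B). -/
theorem exists_extension_of_mem_matrixRange {A : Fin d → H →L[ℂ] H} {B : Fin d → K →L[ℂ] K}
    (h : Equivalent A B) {n : ℕ} {X : Fin d → Mat n} (hX : X ∈ matrixRange n A) :
    ∃ Φ : (K →L[ℂ] K) →ₗ[ℂ] Mat n, IsCP Φ ∧ Φ 1 = 1 ∧ ∀ i, Φ (B i) = X i := by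
  obtain ⟨ρ, hρ, hB⟩ := h.exists_faithful
  obtain ⟨φ, hφ, h1, hφX⟩ := mem_matrixRange_iff.1 hX
  obtain ⟨Φ, hΦ, hΦφ⟩ := hφ.exists_extension ρ hρ (EuclideanSpace.basisFun (Fin n) ℂ)
  refine ⟨Φ, hΦ, ?_, fun i => ?_⟩
  · rw [← map_one ρ, hΦφ, h1]
  · rw [← hB, hΦφ, hφX]

theorem mem_matrixRange_of_equivalent {A : Fin d → H →L[ℂ] H} {B : Fin d → K →L[ℂ] K}
    (h : Equivalent A B) {n : ℕ} {Φ : (K →L[ℂ] K) →ₗ[ℂ] Mat n} (hΦ : IsCP Φ) (h1 : Φ 1 = 1) :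
    (fun i => Φ (B i)) ∈ matrixRange n A := by
  obtain ⟨ρ, -, hB⟩ := h.exists_faithful
  refine mem_matrixRange_iff.2 ⟨Φ ∘ₗ ρ.toAlgHom.toLinearMap, hΦ.comp (isCP_starAlgHom ρ), ?_,
    fun i => ?_⟩
  · exact (congrArg Φ (map_one ρ)).trans h1
  · exact congrArg Φ (hB i)

/-- Compression to `M` followed by an extension to B(M) is a UCP map on B(L) that sends `V` to `X`.
-/
theorem DilatesTo.matrixRange_subset {A : Fin d → H →L[ℂ] H} {B : Fin d → K →L[ℂ] K}
    (h : DilatesTo A B) (n : ℕ) : matrixRange n A ⊆ matrixRange n B := by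
  obtain ⟨L, _, _, _, M, _, U, V, hAU, hBV, hUV⟩ := h
  intro X hX
  obtain ⟨Φ, hΦ, h1, hΦX⟩ := exists_extension_of_mem_matrixRange hAU hX
  have hJ : compress M.subtypeₗᵢ.toContinuousLinearMap 1 = 1 := compress_one M.subtypeₗᵢ
  have := mem_matrixRange_of_equivalent hBV
    (hΦ.comp (isCP_compress M.subtypeₗᵢ.toContinuousLinearMap)) (by
      rw [LinearMap.comp_apply, hJ, h1])
  convert this using 1
  ext1 i
  rw [← hΦX, LinearMap.comp_apply]
  congr 1
  ext1 y
  refine ext_inner_left ℂ fun x => ?_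
  rw [inner_compress, hUV]
  simp

theorem dmrTo_le_drDTo (A : Fin d → H →L[ℂ] H) (B : Fin d → K →L[ℂ] K) :
    dmrTo A B ≤ drDTo A B := by
  refine le_sInf ?_
  rintro _ ⟨L, _, _, _, A', C, hA, hC, rfl⟩
  refine iSup₂_le fun n _ => iSup₂_le fun X hX => ?_
  obtain ⟨Φ, hΦ, h1, hΦX⟩ := exists_extension_of_mem_matrixRange hA hX
  -- The competitor for `X = Φ(A')` is `Φ(C)`.
  refine (iInf₂_le _ (hC.matrixRange_subset n
    (mem_matrixRange_of_equivalent (Equivalent.refl C) hΦ h1))).trans ?_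
  rw [enorm_le_iff_norm_le, pi_norm_le_iff_of_nonneg (norm_nonneg _)]
  intro i
  rw [Pi.sub_apply, ← hΦX, ← map_sub]
  exact (hΦ.norm_le h1 _).trans (norm_le_pi_norm (A' - C) i)

end LowerBound

/-! ### Direct sums, and dilations of UCP images -/

section Dilation

theorem prodLp_ext {H K : Type*} {z w : WithLp 2 (H × K)} (h₁ : z.fst = w.fst)
    (h₂ : z.snd = w.snd) : z = w :=
  WithLp.ofLp_injective 2 (Prod.ext h₁ h₂)

variable {S : Type*} [Ring S] [StarRing S] [Algebra ℂ S]
variable {H : Type*} [NormedAddCommGroup H] [InnerProductSpace ℂ H]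
variable {K : Type*} [NormedAddCommGroup K] [InnerProductSpace ℂ K]

/-- The diagonal operator `T ⊕ T'`. -/
def diagOp (T : H →L[ℂ] H) (T' : K →L[ℂ] K) : WithLp 2 (H × K) →L[ℂ] WithLp 2 (H × K) :=
  (WithLp.prodContinuousLinearEquiv 2 ℂ H K).symm.toContinuousLinearMap ∘L
    (T.prodMap T') ∘L (WithLp.prodContinuousLinearEquiv 2 ℂ H K).toContinuousLinearMap

theorem diagOp_apply (T : H →L[ℂ] H) (T' : K →L[ℂ] K) (z : WithLp 2 (H × K)) :
    diagOp T T' z = WithLp.toLp 2 (T z.fst, T' z.snd) := rfl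

variable [CompleteSpace H] [CompleteSpace K]

/-- The direct sum of two representations. -/
def directSum (π : S →⋆ₐ[ℂ] (H →L[ℂ] H)) (σ : S →⋆ₐ[ℂ] (K →L[ℂ] K)) :
    S →⋆ₐ[ℂ] (WithLp 2 (H × K) →L[ℂ] WithLp 2 (H × K)) where
  toFun a := diagOp (π a) (σ a)
  map_one' := by ext1 z; apply prodLp_ext <;> simp [diagOp_apply]
  map_mul' _ _ := by ext1 z; apply prodLp_ext <;> simp [diagOp_apply]
  map_zero' := by ext1 z; apply prodLp_ext <;> simp [diagOp_apply]
  map_add' _ _ := by ext1 z; apply prodLp_ext <;> simp [diagOp_apply]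
  commutes' c := by ext1 z; apply prodLp_ext <;> simp [diagOp_apply, Algebra.algebraMap_eq_smul_one]
  map_star' a := by
    ext1 z
    refine ext_inner_left ℂ fun w => ?_
    rw [ContinuousLinearMap.star_eq_adjoint, ContinuousLinearMap.adjoint_inner_right]
    simp [diagOp_apply, WithLp.prod_inner_apply, map_star, ContinuousLinearMap.star_eq_adjoint,
      ContinuousLinearMap.adjoint_inner_right]

theorem directSum_apply (π : S →⋆ₐ[ℂ] (H →L[ℂ] H)) (σ : S →⋆ₐ[ℂ] (K →L[ℂ] K)) (a : S)
    (z : WithLp 2 (H × K)) : directSum π σ a z = WithLp.toLp 2 (π a z.fst, σ a z.snd) := rfl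

theorem directSum_injective (π : S →⋆ₐ[ℂ] (H →L[ℂ] H)) {σ : S →⋆ₐ[ℂ] (K →L[ℂ] K)}
    (hσ : Function.Injective σ) : Function.Injective (directSum π σ) := fun a b h =>
  hσ <| ContinuousLinearMap.ext fun y => by
    have := congrArg (fun T => (T (WithLp.toLp 2 (0, y))).snd) h
    simpa [directSum_apply] using this

end Dilation

section DilationOfTuples

variable {d : ℕ}
variable {H : Type u} [NormedAddCommGroup H] [InnerProductSpace ℂ H] [CompleteSpace H]
variable {K : Type u} [NormedAddCommGroup K] [InnerProductSpace ℂ K] [CompleteSpace K]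

/-- The compression of a tuple equivalent to `B` by an isometry dilates to `B`. -/
theorem dilatesTo_compress {L : Type u} [NormedAddCommGroup L] [InnerProductSpace ℂ L]
    [CompleteSpace L] {B : Fin d → K →L[ℂ] K} {V : Fin d → L →L[ℂ] L} (hBV : Equivalent B V)
    (W : H →ₗᵢ[ℂ] L) : DilatesTo (fun i => compress W.toContinuousLinearMap (V i)) B := by
  let M : Submodule ℂ L := LinearMap.range W.toLinearMap
  let e : H ≃ₗᵢ[ℂ] M := W.equivRange
  have hM : CompleteSpace M := e.toIsometryEquiv.completeSpace_iff.1 inferInstance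
  refine ⟨L, inferInstance, inferInstance, inferInstance, M, hM,
    fun i => M.orthogonalProjectionOnto ∘L V i ∘L M.subtypeL, V, ?_, hBV, fun i => rfl⟩
  refine equivalent_of_injective
    ((e.conjStarAlgEquiv : (H →L[ℂ] H) →⋆ₐ[ℂ] (M →L[ℂ] M)).comp (cstar _).subtype)
    (e.conjStarAlgEquiv.injective.comp Subtype.val_injective) fun i => ?_
  ext1 y
  obtain ⟨y, rfl⟩ := e.surjective y
  refine ext_inner_left ℂ fun x => ?_
  obtain ⟨x, rfl⟩ := e.surjective x
  change ⟪e x, e (compress W.toContinuousLinearMap (V i) (e.symm (e y)))⟫_ℂ =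
    ⟪e x, M.orthogonalProjectionOnto (V i (W y))⟫_ℂ
  rw [e.symm_apply_apply, e.inner_map_map, inner_compress,
    Submodule.inner_orthogonalProjectionOnto_eq_of_mem_left]
  rfl

/-- The Stinespring representation need not be faithful, so the identity representation of C*(B) on
`K` is added; the isometry `x ↦ (V x, 0)` does not see it. -/
theorem IsCP.dilatesTo {B : Fin d → K →L[ℂ] K} {ψ : cstar B →ₗ[ℂ] (H →L[ℂ] H)} (hψ : IsCP ψ)
    (h1 : ψ 1 = 1) : DilatesTo (fun i => ψ (gen B i)) B := by
  obtain ⟨L, _, _, _, π, V, hV⟩ := hψ.exists_dilation h1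
  let W : H →ₗᵢ[ℂ] WithLp 2 (L × K) :=
    { toFun := fun x => WithLp.toLp 2 (V x, 0)
      map_add' := fun _ _ => by apply prodLp_ext <;> simp
      map_smul' := fun _ _ => by apply prodLp_ext <;> simp
      norm_map' := fun x => by simp }
  have hσ : Equivalent B (fun i => directSum π (cstar B).subtype (gen B i)) :=
    equivalent_of_injective _ (directSum_injective π Subtype.val_injective) fun i => rfl
  convert dilatesTo_compress hσ W using 1
  ext1 i
  ext1 y
  refine ext_inner_left ℂ fun x => ?_
  rw [inner_compress, ← hV, directSum_apply, WithLp.prod_inner_apply]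
  simp [W]

end DilationOfTuples

/-! ### Weak limits along ultrafilters -/

section Limits

open Filter Topology

variable {H : Type*} [NormedAddCommGroup H] [InnerProductSpace ℂ H] [CompleteSpace H]
variable {ι : Type*}

/-- Bounded families of operators converge weakly along ultrafilters. -/
theorem exists_tendsto_inner (U : Ultrafilter ι) (T : ι → H →L[ℂ] H) {C : ℝ}
    (hT : ∀ F, ‖T F‖ ≤ C) :
    ∃ T₀ : H →L[ℂ] H, ∀ x y, Tendsto (fun F => ⟪x, T F y⟫_ℂ) U (𝓝 ⟪x, T₀ y⟫_ℂ) := by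
  have hbd : ∀ F x y, ‖⟪T F x, y⟫_ℂ‖ ≤ C * ‖x‖ * ‖y‖ := fun F x y =>
    (norm_inner_le_norm _ _).trans <| by
      gcongr
      exact (T F).le_of_opNorm_le (hT F) x
  have hlim : ∀ x y, ∃ l : ℂ, ‖l‖ ≤ C * ‖x‖ * ‖y‖ ∧ Tendsto (fun F => ⟪T F x, y⟫_ℂ) U (𝓝 l) := by
    intro x y
    obtain ⟨l, hl, hUl⟩ := (isCompact_closedBall (0 : ℂ) (C * ‖x‖ * ‖y‖)).ultrafilter_le_nhds
      (U.map fun F => ⟪T F x, y⟫_ℂ) (by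
        rw [le_principal_iff]
        exact Filter.mem_map.2 (univ_mem' fun F => by simpa using hbd F x y))
    exact ⟨l, by simpa using hl, hUl⟩
  choose l hl hlT using hlim
  let f : H →ₗ⋆[ℂ] H →ₗ[ℂ] ℂ := LinearMap.mk₂'ₛₗ (starRingEnd ℂ) (RingHom.id ℂ) l
    (fun x x' y => tendsto_nhds_unique (hlT _ _) <| by
      simpa only [map_add, inner_add_left] using (hlT x y).add (hlT x' y))
    (fun c x y => tendsto_nhds_unique (hlT _ _) <| by
      simpa only [map_smul, inner_smul_left, smul_eq_mul] using (hlT x y).const_mul (conj c))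
    (fun x y y' => tendsto_nhds_unique (hlT _ _) <| by
      simpa only [inner_add_right] using (hlT x y).add (hlT x y'))
    (fun c x y => tendsto_nhds_unique (hlT _ _) <| by
      simpa only [inner_smul_right, RingHom.id_apply, smul_eq_mul] using (hlT x y).const_mul c)
  -- The limits form a bounded sesquilinear form, which Riesz represents by an operator in the first
  -- slot; conjugation moves it to the second.
  let g : H →L⋆[ℂ] H →L[ℂ] ℂ := f.mkContinuous₂ C hl
  refine ⟨InnerProductSpace.continuousLinearMapOfBilin g, fun x y => ?_⟩
  have h1 : ⟪InnerProductSpace.continuousLinearMapOfBilin g y, x⟫_ℂ = l y x :=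
    InnerProductSpace.continuousLinearMapOfBilin_apply g y x
  have h2 := ((Complex.continuous_conj.tendsto _).comp (hlT y x))
  simpa only [Function.comp_def, inner_conj_symm, ← h1] using h2

/-- Contractive families of completely positive maps converge pointwise weakly along
ultrafilters, and the limit is completely positive. -/
theorem exists_isCP_limit {S : Type*} [CStarAlgebra S] (U : Ultrafilter ι)
    (ψ : ι → S →ₗ[ℂ] (H →L[ℂ] H)) (hψ : ∀ F, IsCP (ψ F)) (hbd : ∀ F a, ‖ψ F a‖ ≤ ‖a‖) :
    ∃ ψ₀ : S →ₗ[ℂ] (H →L[ℂ] H), IsCP ψ₀ ∧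
      ∀ a x y, Tendsto (fun F => ⟪x, ψ F a y⟫_ℂ) U (𝓝 ⟪x, ψ₀ a y⟫_ℂ) := by
  choose T hT using fun a => exists_tendsto_inner U (fun F => ψ F a) (fun F => hbd F a)
  have hext : ∀ {T₁ T₂ : H →L[ℂ] H}, (∀ x y, ⟪x, T₁ y⟫_ℂ = ⟪x, T₂ y⟫_ℂ) → T₁ = T₂ := fun h =>
    ContinuousLinearMap.ext fun y => ext_inner_left ℂ fun x => h x y
  let ψ₀ : S →ₗ[ℂ] (H →L[ℂ] H) :=
    { toFun := T
      map_add' := fun a b => hext fun x y => tendsto_nhds_unique (hT _ x y) <| by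
        simpa only [map_add, add_apply, inner_add_right] using (hT a x y).add (hT b x y)
      map_smul' := fun c a => hext fun x y => tendsto_nhds_unique (hT _ x y) <| by
        simpa only [map_smul, smul_apply, inner_smul_right, RingHom.id_apply] using
          (hT a x y).const_mul c }
  refine ⟨ψ₀, fun k a x => ?_, hT⟩
  exact ge_of_tendsto' (tendsto_finsetSum _ fun i _ => tendsto_finsetSum _ fun j _ =>
    hT (star (a i) * a j) (x i) (x j)) fun F => hψ F k a x

end Limits

/-! ### The relaxed dilation distance is at most the matrix range distance -/

section UpperBound

open Filter Topology

variable {d : ℕ}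
variable {H : Type u} [NormedAddCommGroup H] [InnerProductSpace ℂ H] [CompleteSpace H]
variable {K : Type u} [NormedAddCommGroup K] [InnerProductSpace ℂ K] [CompleteSpace K]

theorem compress_mem_matrixRange (A : Fin d → H →L[ℂ] H) {n : ℕ}
    (J : EuclideanSpace ℂ (Fin n) →ₗᵢ[ℂ] H) :
    (fun i => compress J.toContinuousLinearMap (A i)) ∈ matrixRange n A :=
  mem_matrixRange_of_equivalent (Equivalent.refl A) (isCP_compress _) (compress_one J)

theorem exists_mem_matrixRange_norm_sub_le {A : Fin d → H →L[ℂ] H} {B : Fin d → K →L[ℂ] K}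
    {t : NNReal} (ht : dmrTo A B < t) {n : ℕ} (hn : 1 ≤ n) {X : Fin d → Mat n}
    (hX : X ∈ matrixRange n A) : ∃ Y ∈ matrixRange n B, ‖X - Y‖ ≤ t := by
  have h : ⨅ Y ∈ matrixRange n B, ‖X - Y‖ₑ < t :=
    ((le_iSup₂ (f := fun X (_ : X ∈ matrixRange n A) => ⨅ Y ∈ matrixRange n B, ‖X - Y‖ₑ)
      X hX).trans (le_iSup₂ (f := fun n (_ : 1 ≤ n) => ⨆ X ∈ matrixRange n A,
        ⨅ Y ∈ matrixRange n B, ‖X - Y‖ₑ) n hn)).trans_lt ht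
  obtain ⟨Y, hY⟩ := iInf_lt_iff.1 h
  obtain ⟨hY, hlt⟩ := iInf_lt_iff.1 hY
  refine ⟨Y, hY, ?_⟩
  rw [enorm_eq_nnnorm, ENNReal.coe_lt_coe] at hlt
  exact_mod_cast hlt.le

/-- On finitely many vectors, `A` is approximated by the image of `B` under a completely positive
map. -/
theorem exists_isCP_approx {A : Fin d → H →L[ℂ] H} {B : Fin d → K →L[ℂ] K} {t : NNReal}
    (ht : dmrTo A B < t) (F : Finset H) :
    ∃ ψ : cstar B →ₗ[ℂ] (H →L[ℂ] H), IsCP ψ ∧ (∀ b, ‖ψ b‖ ≤ ‖b‖) ∧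
      ∀ x ∈ F, ∀ y ∈ F, ⟪x, ψ 1 y⟫_ℂ = ⟪x, y⟫_ℂ ∧
        ∀ i, ‖⟪x, A i y⟫_ℂ - ⟪x, ψ (gen B i) y⟫_ℂ‖ ≤ t * ‖x‖ * ‖y‖ := by
  let W : Submodule ℂ H := Submodule.span ℂ (F : Set H)
  have hFW : ∀ x ∈ F, x ∈ W := fun x hx => Submodule.subset_span hx
  have : FiniteDimensional ℂ W := FiniteDimensional.span_finset ℂ F
  -- Level `0` does not enter `dmrTo`, so a trivial span is treated apart, with `ψ = 0`.
  rcases Nat.eq_zero_or_pos (Module.finrank ℂ W) with h0 | hpos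
  · have hW : W = ⊥ := Submodule.finrank_eq_zero.1 h0
    have hF : ∀ x ∈ F, x = 0 := fun x hx => by simpa [hW] using hFW x hx
    refine ⟨0, fun k a x => by simp, fun b => by simp, fun x hx y hy => ?_⟩
    rw [hF x hx, hF y hy]
    simp
  · let e := (stdOrthonormalBasis ℂ W).repr
    let J : EuclideanSpace ℂ (Fin (Module.finrank ℂ W)) →ₗᵢ[ℂ] H :=
      W.subtypeₗᵢ.comp e.symm.toLinearIsometry
    have hJF : ∀ x ∈ F, ∃ u, J u = x := fun x hx => ⟨e ⟨x, hFW x hx⟩, by simp [J]⟩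
    obtain ⟨Y, hY, hXY⟩ := exists_mem_matrixRange_norm_sub_le ht hpos
      (compress_mem_matrixRange A J)
    obtain ⟨φ, hφ, h1, hφY⟩ := mem_matrixRange_iff.1 hY
    let J' := J.toContinuousLinearMap
    have hJ' : ∀ u, J'.adjoint (J u) = u := fun u => by
      have := congrArg (fun T => T u) (compress_one J)
      simpa [compress] using this
    -- The map `b ↦ J φ(b) J⋆` is contractive; it sends `1` to the projection onto `W`, which acts
    -- as the identity on `F`.
    refine ⟨compress J'.adjoint ∘ₗ φ, (isCP_compress _).comp hφ, fun b => ?_, ?_⟩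
    · have hJ1 : ‖J'‖ ≤ 1 := J.norm_toContinuousLinearMap_le
      have hJ2 : ‖J'.adjoint‖ ≤ 1 := by rwa [LinearIsometryEquiv.norm_map]
      calc ‖compress J'.adjoint (φ b)‖ ≤ ‖J'.adjoint.adjoint‖ * (‖φ b‖ * ‖J'.adjoint‖) :=
            (ContinuousLinearMap.opNorm_comp_le _ _).trans
              (by gcongr; exact ContinuousLinearMap.opNorm_comp_le _ _)
        _ ≤ 1 * (‖b‖ * 1) := by
            rw [ContinuousLinearMap.adjoint_adjoint]
            gcongr
            exact hφ.norm_le h1 b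
        _ = ‖b‖ := by ring
    · intro x hx y hy
      obtain ⟨u, rfl⟩ := hJF x hx
      obtain ⟨w, rfl⟩ := hJF y hy
      simp only [LinearMap.comp_apply, inner_compress, hJ']
      refine ⟨?_, fun i => ?_⟩
      · rw [h1, one_apply_eq_self, J.inner_map_map]
      · have h2 : ⟪J u, A i (J w)⟫_ℂ = ⟪u, compress J' (A i) w⟫_ℂ := (inner_compress J' _ _ _).symm
        rw [h2, hφY, ← inner_sub_right, ← sub_apply, J.norm_map, J.norm_map]
        calc _ ≤ ‖u‖ * ‖(compress J' (A i) - Y i) w‖ := norm_inner_le_norm _ _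
          _ ≤ ‖u‖ * (t * ‖w‖) := by
              gcongr
              exact ContinuousLinearMap.le_of_opNorm_le _
                ((norm_le_pi_norm ((fun i => compress J' (A i)) - Y) i).trans hXY) w
          _ = _ := by ring

theorem exists_isCP_norm_sub_le {A : Fin d → H →L[ℂ] H} {B : Fin d → K →L[ℂ] K} {t : NNReal}
    (ht : dmrTo A B < t) :
    ∃ ψ : cstar B →ₗ[ℂ] (H →L[ℂ] H), IsCP ψ ∧ ψ 1 = 1 ∧ ∀ i, ‖A i - ψ (gen B i)‖ ≤ t := by
  classical
  choose ψ hψ hbd hF using exists_isCP_approx ht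
  -- Any two vectors eventually lie in `F` along `U`, so the limit is unital and inherits the
  -- estimates at every pair of vectors.
  let U : Ultrafilter (Finset H) := Ultrafilter.of atTop
  have hU : (U : Filter (Finset H)) ≤ atTop := Ultrafilter.of_le atTop
  obtain ⟨ψ₀, hψ₀, hlim⟩ := exists_isCP_limit U ψ hψ hbd
  have hev : ∀ x y : H, ∀ᶠ F : Finset H in U, x ∈ F ∧ y ∈ F := fun x y =>
    Filter.Eventually.filter_mono hU ((eventually_ge_atTop ({x, y} : Finset H)).mono fun F hF =>
      ⟨hF (by simp), hF (by simp)⟩)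
  refine ⟨ψ₀, hψ₀, ?_, fun i => ?_⟩
  · ext1 y
    refine ext_inner_left ℂ fun x => tendsto_nhds_unique (hlim 1 x y) ?_
    refine tendsto_const_nhds.congr' ((hev x y).mono fun F h => ?_)
    exact ((hF F x h.1 y h.2).1).symm
  · have key : ∀ x y, ‖⟪x, (A i - ψ₀ (gen B i)) y⟫_ℂ‖ ≤ t * ‖x‖ * ‖y‖ := fun x y => by
      rw [sub_apply, inner_sub_right]
      refine le_of_tendsto ((tendsto_const_nhds.sub (hlim (gen B i) x y)).norm)
        ((hev x y).mono fun F h => (hF F x h.1 y h.2).2 i)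
    refine ContinuousLinearMap.opNorm_le_bound _ t.2 fun y => ?_
    -- Testing against the image vector itself gives its squared norm; one factor is then cancelled.
    have h := key ((A i - ψ₀ (gen B i)) y) y
    rw [inner_self_eq_norm_sq_to_K, norm_pow, RCLike.norm_ofReal, abs_norm] at h
    rcases (norm_nonneg ((A i - ψ₀ (gen B i)) y)).eq_or_lt with h0 | hpos
    · rw [← h0]
      exact mul_nonneg t.2 (norm_nonneg y)
    · refine le_of_mul_le_mul_left ?_ hpos
      calc _ = ‖(A i - ψ₀ (gen B i)) y‖ ^ 2 := (sq _).symm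
        _ ≤ _ := h
        _ = _ := by
          rw [mul_comm (t : ℝ), mul_assoc]

theorem drDTo_le_dmrTo (A : Fin d → H →L[ℂ] H) (B : Fin d → K →L[ℂ] K) :
    drDTo A B ≤ dmrTo A B := by
  refine ENNReal.le_of_forall_pos_le_add ?_
  intro ε hε hlt
  lift dmrTo A B to NNReal using hlt.ne with r hr
  have ht : dmrTo A B < (r + ε : NNReal) := by
    rw [← hr, ENNReal.coe_lt_coe]
    exact lt_add_of_pos_right r hε
  obtain ⟨ψ, hψ, h1, hA⟩ := exists_isCP_norm_sub_le ht
  have h0 : drDTo A B ≤ ‖A - fun i => ψ (gen B i)‖ₑ :=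
    sInf_le ⟨H, inferInstance, inferInstance, inferInstance, A, fun i => ψ (gen B i),
      Equivalent.refl A, hψ.dilatesTo h1, rfl⟩
  refine h0.trans ?_
  rw [enorm_eq_nnnorm, ← ENNReal.coe_add, ENNReal.coe_le_coe]
  have h2 : ‖A - fun i => ψ (gen B i)‖ ≤ (r + ε : NNReal) :=
    (pi_norm_le_iff_of_nonneg (NNReal.coe_nonneg _)).2 hA
  exact_mod_cast h2

theorem dmrTo_eq_drDTo (A : Fin d → H →L[ℂ] H) (B : Fin d → K →L[ℂ] K) :
    dmrTo A B = drDTo A B :=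
  le_antisymm (dmrTo_le_drDTo A B) (drDTo_le_dmrTo A B)

end UpperBound

end OperatorTuple

end

theorem corollary1p3 {d : ℕ}
    {H : Type u} [NormedAddCommGroup H] [InnerProductSpace ℂ H] [CompleteSpace H]
    {K : Type u} [NormedAddCommGroup K] [InnerProductSpace ℂ K] [CompleteSpace K]
    (A : Fin d → H →L[ℂ] H) (B : Fin d → K →L[ℂ] K) :
    OperatorTuple.dmrTo A B = OperatorTuple.drDTo A B ∧
      OperatorTuple.dmr A B = OperatorTuple.drD A B := by
  refine ⟨OperatorTuple.dmrTo_eq_drDTo A B, ?_⟩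
  rw [OperatorTuple.dmr_eq_max, OperatorTuple.drD, OperatorTuple.dmrTo_eq_drDTo A B,
    OperatorTuple.dmrTo_eq_drDTo B A]
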